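/- There is a constant $C_0>0$ with the following property. Let $V:\mathbb{R}^3\to\mathbb{C}^{4\times4}$ be a measurable matrix-valued function with $V(x)=V(x)^*$ for almost every $x$ and $$\|V\|_{L^{3,\infty}}:=\sup_{t>0}\,t^{1/3}\,|V|^*(t)\le C_0,\qquad |V|^*(t):=\inf\{s>0:\ |\{x:|V(x)|>s\}|\le t\},$$ where $|V(x)|$ is the operator norm of $V(x)$ on $\mathbb{C}^4$. Let $\mathcal{D}=\frac1i\sum_{k=1}^3\alpha_k\partial_k$ be the free massless Dirac operator on $L^2(\mathbb{R}^3,\mathbb{C}^4)$ with domain $H^1(\mathbb{R}^3,\mathbb{C}^4)$, with the Dirac matrices $$\alpha_1=\begin{pmatrix}0&0&0&1\\0&0&1&0\\0&1&0&0\\1&0&0&0\end{pmatrix},\quad \alpha_2=\begin{pmatrix}0&0&0&-i\\0&0&i&0\\0&-i&0&0\\i&0&0&0\end{pmatrix},\quad \alpha_3=\begin{pmatrix}0&0&1&0\\0&0&0&-1\\1&0&0&0\\0&-1&0&0\end{pmatrix}.$$ Then $V\psi\in L^2(\mathbb{R}^3,\mathbb{C}^4)$ for every $\psi\in H^1(\mathbb{R}^3,\mathbb{C}^4)$,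 and the perturbed Dirac operator $\mathcal{D}_V=\mathcal{D}+V$ with domain $H^1(\mathbb{R}^3,\mathbb{C}^4)$ is a self-adjoint unbounded operator on $L^2(\mathbb{R}^3,\mathbb{C}^4)$. -/

import Mathlib

open MeasureTheory TemperedDistribution
open scoped ENNReal SchwartzMap LineDeriv

noncomputable section

namespace DiracLorentz

/-- Physical space `ℝ³`, with its Euclidean norm and Lebesgue measure. -/
abbrev R3 : Type := EuclideanSpace ℝ (Fin 3)

/-- The spinor space `ℂ⁴`, with its Hermitian inner product. -/
abbrev Spinor : Type := EuclideanSpace ℂ (Fin 4)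

/-- The Hilbert space `L²(ℝ³, ℂ⁴)`. -/
abbrev L2 : Type := Lp Spinor 2 (volume : Measure R3)

/-- The Dirac matrices `α₁, α₂, α₃` (indexed by `0, 1, 2`). -/
def diracMatrix : Fin 3 → Matrix (Fin 4) (Fin 4) ℂ :=
  ![!![0, 0, 0, 1; 0, 0, 1, 0; 0, 1, 0, 0; 1, 0, 0, 0],
    !![0, 0, 0, -Complex.I; 0, 0, Complex.I, 0; 0, -Complex.I, 0, 0; Complex.I, 0, 0, 0],
    !![0, 0, 1, 0; 0, 0, 0, -1; 1, 0, 0, 0; 0, -1, 0, 0]]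

/-- A `4 × 4` complex matrix as a (bounded) operator on `ℂ⁴`. -/
abbrev matrixOp (M : Matrix (Fin 4) (Fin 4) ℂ) : Spinor →L[ℂ] Spinor :=
  Matrix.toEuclideanCLM (𝕜 := ℂ) M

/-! ### The Lorentz quasinorm `L^{p,∞}` -/

/-- The non-increasing rearrangement `f^*(t) = inf {s > 0 : |{x : f x > s}| ≤ t}` of a nonnegative
function on `ℝ³`. (The value `s = ∞` always qualifies, so that the infimum is `∞` exactly when no
finite `s` does.) -/
def rearrangement (f : R3 → ℝ≥0∞) (t : ℝ≥0∞) : ℝ≥0∞ :=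
  sInf {s : ℝ≥0∞ | 0 < s ∧ volume {x | s < f x} ≤ t}

/-- The Lorentz (weak Lebesgue) quasinorm
`‖V‖_{L^{p,∞}} = sup_{0 < t < ∞} t^{1/p} |V|^*(t)` of a matrix-valued function on `ℝ³`, where
`|V(x)|` is the operator norm of the matrix `V(x)` on `ℂ⁴`. -/
def weakLorentzNorm (p : ℝ) (V : R3 → Matrix (Fin 4) (Fin 4) ℂ) : ℝ≥0∞ :=
  ⨆ (t : ℝ) (_ : 0 < t),
    ENNReal.ofReal (t ^ (1 / p)) * rearrangement (fun x ↦ ‖matrixOp (V x)‖ₑ) (ENNReal.ofReal t)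

/-! ### The Sobolev space `H¹(ℝ³, ℂ⁴)` and the free Dirac operator -/

/-- The Sobolev space `H¹(ℝ³, ℂ⁴)`, as a linear subspace of `L²(ℝ³, ℂ⁴)`. -/
def sobolevH1 : Submodule ℂ L2 where
  carrier := {ψ | MemSobolev 1 2 (ψ : 𝓢'(R3, Spinor))}
  zero_mem' := by
    have h : ((0 : L2) : 𝓢'(R3, Spinor)) = 0 := by
      rw [← Lp.toTemperedDistributionCLM_apply, map_zero]
    change MemSobolev 1 2 ((0 : L2) : 𝓢'(R3, Spinor))
    rw [h]
    exact memSobolev_fun_zero R3 Spinor 1 2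
  add_mem' {φ ψ} hφ hψ := by
    have h : ((φ + ψ : L2) : 𝓢'(R3, Spinor)) = (φ : 𝓢'(R3, Spinor)) + ψ := by
      simp only [← Lp.toTemperedDistributionCLM_apply, map_add]
    change MemSobolev 1 2 ((φ + ψ : L2) : 𝓢'(R3, Spinor))
    rw [h]
    exact MemSobolev.add hφ hψ
  smul_mem' c ψ hψ := by
    have h : ((c • ψ : L2) : 𝓢'(R3, Spinor)) = c • (ψ : 𝓢'(R3, Spinor)) := by
      simp only [← Lp.toTemperedDistributionCLM_apply, map_smul]
    change MemSobolev 1 2 ((c • ψ : L2) : 𝓢'(R3, Spinor))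
    rw [h]
    exact MemSobolev.smul c hψ

/-- An `L²` function is determined by the tempered distribution that it defines. -/
theorem toTemperedDistribution_injective {f g : L2}
    (h : (f : 𝓢'(R3, Spinor)) = (g : 𝓢'(R3, Spinor))) : f = g :=
  LinearMap.ker_eq_bot.1
    (Lp.ker_toTemperedDistributionCLM_eq_bot (F := Spinor) (μ := (volume : Measure R3)) (p := 2)) h

/-- The distributional derivative of an `H¹` function is an `L²` function. -/
theorem exists_weakDeriv (m : R3) (ψ : sobolevH1) :
    ∃ g : L2, (g : 𝓢'(R3, Spinor)) = ∂_{m} ((ψ : L2) : 𝓢'(R3, Spinor)) := by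
  have h := MemSobolev.lineDerivOp (m := m) (show MemSobolev 1 2 _ from ψ.2)
  rw [sub_self, memSobolev_zero_iff] at h
  obtain ⟨g, hg⟩ := h
  exact ⟨g, hg.symm⟩

/-- The weak (that is, distributional) derivative in the direction `m`, from `H¹` to `L²`. -/
def weakDeriv (m : R3) : sobolevH1 →ₗ[ℂ] L2 where
  toFun ψ := (exists_weakDeriv m ψ).choose
  map_add' φ ψ := by
    apply toTemperedDistribution_injective
    rw [(exists_weakDeriv m (φ + ψ)).choose_spec]
    simp only [← Lp.toTemperedDistributionCLM_apply, map_add, Submodule.coe_add,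
      LineDeriv.lineDerivOp_add]
    simp only [Lp.toTemperedDistributionCLM_apply, (exists_weakDeriv m _).choose_spec]
  map_smul' c ψ := by
    apply toTemperedDistribution_injective
    rw [(exists_weakDeriv m (c • ψ)).choose_spec]
    simp only [← Lp.toTemperedDistributionCLM_apply, map_smul, Submodule.coe_smul,
      LineDeriv.lineDerivOp_smul, RingHom.id_apply]
    simp only [Lp.toTemperedDistributionCLM_apply, (exists_weakDeriv m _).choose_spec]

/-- The characteristic property of the weak derivative. -/
theorem weakDeriv_spec (m : R3) (ψ : sobolevH1) :
    (weakDeriv m ψ : 𝓢'(R3, Spinor)) = ∂_{m} ((ψ : L2) : 𝓢'(R3, Spinor)) :=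
  (exists_weakDeriv m ψ).choose_spec

/-- The free massless Dirac operator `𝒟 = (1/i) ∑ₖ αₖ ∂ₖ`, an unbounded operator in
`L²(ℝ³, ℂ⁴)` with domain `H¹(ℝ³, ℂ⁴)`. -/
def freeDirac : L2 →ₗ.[ℂ] L2 where
  domain := sobolevH1
  toFun := (1 / Complex.I) • ∑ k : Fin 3,
    ((matrixOp (diracMatrix k)).compLpL 2 (volume : Measure R3)).toLinearMap ∘ₗ
      weakDeriv (EuclideanSpace.single k 1)

/-! ### The perturbed Dirac operator -/

/-- The maximal domain `{ψ ∈ L² : Vψ ∈ L²}` of multiplication by the matrix-valued function `V`. -/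
def mulDomain (V : R3 → Matrix (Fin 4) (Fin 4) ℂ) : Submodule ℂ L2 where
  carrier := {ψ | MemLp (fun x ↦ matrixOp (V x) (ψ x)) 2 (volume : Measure R3)}
  zero_mem' := by
    refine (memLp_congr_ae ?_).2 (MemLp.zero (ε := Spinor))
    filter_upwards [Lp.coeFn_zero Spinor 2 (volume : Measure R3)] with x hx
    rw [hx, Pi.zero_apply, map_zero]
  add_mem' {φ ψ} hφ hψ := by
    refine (memLp_congr_ae ?_).2 (MemLp.add hφ hψ)
    filter_upwards [Lp.coeFn_add φ ψ] with x hx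
    rw [hx, Pi.add_apply, Pi.add_apply, map_add]
  smul_mem' c ψ hψ := by
    refine (memLp_congr_ae ?_).2 (MemLp.const_smul hψ c)
    filter_upwards [Lp.coeFn_smul c ψ] with x hx
    rw [hx, Pi.smul_apply, Pi.smul_apply, map_smul]

theorem memLp_mul {V : R3 → Matrix (Fin 4) (Fin 4) ℂ} (ψ : mulDomain V) :
    MemLp (fun x ↦ matrixOp (V x) ((ψ : L2) x)) 2 (volume : Measure R3) :=
  ψ.2

/-- The operator of multiplication by the matrix-valued function `V`, an unbounded operator in
`L²(ℝ³, ℂ⁴)` with its maximal domain. -/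
def mulOp (V : R3 → Matrix (Fin 4) (Fin 4) ℂ) : L2 →ₗ.[ℂ] L2 where
  domain := mulDomain V
  toFun :=
    { toFun := fun ψ ↦ (memLp_mul ψ).toLp (fun x ↦ matrixOp (V x) ((ψ : L2) x))
      map_add' := fun φ ψ ↦ by
        rw [← MemLp.toLp_add (memLp_mul φ) (memLp_mul ψ)]
        apply MemLp.toLp_congr
        filter_upwards [Lp.coeFn_add (φ : L2) (ψ : L2)] with x hx
        rw [Submodule.coe_add, hx, Pi.add_apply, Pi.add_apply, map_add]
      map_smul' := fun c ψ ↦ by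
        rw [RingHom.id_apply, ← MemLp.toLp_const_smul c (memLp_mul ψ)]
        apply MemLp.toLp_congr
        filter_upwards [Lp.coeFn_smul c (ψ : L2)] with x hx
        rw [Submodule.coe_smul, hx, Pi.smul_apply, Pi.smul_apply, map_smul] }

/-- The perturbed Dirac operator `𝒟_V = 𝒟 + V`, the sum of two unbounded operators: its domain is
`{ψ ∈ H¹(ℝ³, ℂ⁴) : Vψ ∈ L²}`. -/
def perturbedDirac (V : R3 → Matrix (Fin 4) (Fin 4) ℂ) : L2 →ₗ.[ℂ] L2 :=
  freeDirac + mulOp V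

end DiracLorentz

end

/-! The theorem is Kato–Rellich for `V` as a perturbation of `𝒟`: everything reduces to `‖Vψ‖ ≤ q
‖𝒟ψ‖` on `H¹` with `q < 1`.

Since the Dirac matrices anticommute and square to one, `𝒟² = -Δ`. This gives `‖𝒟ψ‖² = ∑ ‖∂ₖψ‖²`,
and also the surjectivity of `𝒟 ± 2πi`, by factoring `-Δ + 4π² = (𝒟 + c)(𝒟 - c)` with `c = ±2πi`.

The bound `‖Vψ‖ ≤ C ‖V‖_{3,∞} ∑ ‖∂ₖψ‖` is a Hardy-type inequality, proved by truncation
(`exists_lintegral_weak_mul_sq_le`). A weak `L³` function satisfies `∫_E |V|² ≲ ‖V‖²_{3,∞}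
|E|^{1/3}`. For a Schwartz function `f`, the Sobolev inequality for a smooth cutoff of `‖f‖` between
the heights `s` and `2s` gives `s² |{‖f‖ ≥ 2s}|^{1/3} ≲ ∫_{s < ‖f‖ ≤ 2s} |∇f|²`. With `s = 2^k` the
shells on the right are disjoint, so summing over `k` produces the full gradient norm. Density of
Schwartz functions and Fatou's lemma extend the bound to `H¹`. -/

namespace LinearPMap

/-! ### Criteria for self-adjointness -/

variable {H : Type*} [NormedAddCommGroup H] [InnerProductSpace ℂ H] [CompleteSpace H]

/-- A densely defined symmetric operator `T` such that `T + c` and `T + c̄` are onto is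
self-adjoint. -/
theorem isSelfAdjoint_of_surjective {T : H →ₗ.[ℂ] H} (hd : Dense (T.domain : Set H))
    (hsym : ∀ x y : T.domain, inner ℂ (T x) (y : H) = inner ℂ (x : H) (T y)) (c : ℂ)
    (h₁ : ∀ z, ∃ x : T.domain, T x + c • (x : H) = z)
    (h₂ : ∀ z, ∃ x : T.domain, T x + (starRingEnd ℂ c) • (x : H) = z) :
    IsSelfAdjoint T := by
  rw [isSelfAdjoint_def]
  have hle : T ≤ T.adjoint := IsFormalAdjoint.le_adjoint hd hsym
  refine (eq_of_le_of_domain_eq hle (le_antisymm hle.1 fun y hy ↦ ?_)).symm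
  obtain ⟨x, hx⟩ := h₁ (T.adjoint ⟨y, hy⟩ + c • y)
  suffices h : y - x = 0 by
    rw [sub_eq_zero] at h
    rw [h]
    exact x.2
  -- By the choice of `x`, `y - x` is in the kernel of `T* + c`, hence orthogonal to the range of `T
  -- + c̄`. That range is everything, so `y - x` is orthogonal to itself.
  obtain ⟨w, hw⟩ := h₂ (y - x)
  have e₁ := adjoint_isFormalAdjoint hd ⟨y, hy⟩ w
  have e₂ := hsym x w
  rw [← inner_self_eq_zero (𝕜 := ℂ)]
  nth_rw 2 [← hw]
  have e₃ : inner ℂ (T x + c • (x : H)) (w : H)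
      = inner ℂ (T.adjoint ⟨y, hy⟩ + c • y) (w : H) := by rw [hx]
  simp only [inner_add_left, inner_add_right, inner_sub_left, inner_smul_left,
    inner_smul_right] at *
  rw [← e₁, ← e₂]
  linear_combination -e₃

/-- The **Kato–Rellich theorem** for a relatively bounded perturbation with relative bound less
than one. -/
theorem isSelfAdjoint_of_relativelyBounded {T A B : H →ₗ.[ℂ] H}
    (hTA : T.domain = A.domain) (hTB : T.domain ≤ B.domain)
    (hT : ∀ (x : T.domain) (hA : (x : H) ∈ A.domain) (hB : (x : H) ∈ B.domain),
      T x = A ⟨x, hA⟩ + B ⟨x, hB⟩)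
    (hd : Dense (A.domain : Set H))
    (hA : ∀ x y : A.domain, inner ℂ (A x) (y : H) = inner ℂ (x : H) (A y))
    (hB : ∀ x y : B.domain, inner ℂ (B x) (y : H) = inner ℂ (x : H) (B y))
    {q : ℝ} (hq₀ : 0 ≤ q) (hq : q < 1) (hAB : ∀ (x : A.domain) (hx : (x : H) ∈ B.domain),
      ‖B ⟨x, hx⟩‖ ≤ q * ‖A x‖) {r : ℝ} (hr : r ≠ 0)
    (h₁ : ∀ z, ∃ x : A.domain, A x + (r * Complex.I) • (x : H) = z)
    (h₂ : ∀ z, ∃ x : A.domain, A x - (r * Complex.I) • (x : H) = z) :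
    IsSelfAdjoint T := by
  have hsurj : ∀ r : ℝ, r ≠ 0 → (∀ z, ∃ x : A.domain, A x + (r * Complex.I) • (x : H) = z) →
      ∀ z, ∃ x : T.domain, T x + (r * Complex.I) • (x : H) = z := by
    intro r hr h
    let L : A.domain →ₗ[ℂ] H := A.toFun + (r * Complex.I) • A.domain.subtype
    have hL : ∀ x, L x = A x + (r * Complex.I) • (x : H) := fun x ↦ rfl
    -- Symmetry makes `⟨Ax, x⟩` real, so the cross term vanishes. The identity yields both the
    -- injectivity of `A + ri` and `‖A (A + ri)⁻¹‖ ≤ 1`.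
    have hLn : ∀ x, ‖L x‖ ^ 2 = ‖A x‖ ^ 2 + r ^ 2 * ‖(x : H)‖ ^ 2 := by
      intro x
      have him : (inner ℂ (A x) (x : H)).im = 0 := by
        rw [← Complex.conj_eq_iff_im, inner_conj_symm, hA]
      rw [hL, @norm_add_sq ℂ, inner_smul_right, norm_smul]
      simp only [Complex.mul_re, Complex.mul_im, Complex.ofReal_re, Complex.ofReal_im,
        Complex.I_re, Complex.I_im, RCLike.re_to_complex, him, norm_mul, Complex.norm_real,
        Complex.norm_I, Real.norm_eq_abs, mul_one, mul_pow, sq_abs]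
      ring
    have hinj : Function.Injective L := by
      rw [injective_iff_map_eq_zero]
      intro x hx
      have := hLn x
      rw [hx, norm_zero] at this
      have h0 : r ^ 2 * ‖(x : H)‖ ^ 2 = 0 := by
        have := sq_nonneg ‖A x‖
        have : 0 ≤ r ^ 2 * ‖(x : H)‖ ^ 2 := by positivity
        linarith
      simpa [hr] using h0
    let e := LinearEquiv.ofBijective L ⟨hinj, h⟩
    -- `K = B (A + ri)⁻¹`, so that `T + ri = (1 + K)(A + ri)`. As `‖K‖ ≤ q < 1`, the factor `1 + K`
    -- is inverted by a Neumann series.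
    let K : H →ₗ[ℂ] H := B.toFun ∘ₗ Submodule.inclusion (hTA ▸ hTB) ∘ₗ e.symm.toLinearMap
    have hK : ∀ z, ‖K z‖ ≤ q * ‖z‖ := by
      intro z
      have hz : L (e.symm z) = z := e.apply_symm_apply z
      have h1 : ‖K z‖ ≤ q * ‖A (e.symm z)‖ := hAB (e.symm z) _
      have h2 : ‖A (e.symm z)‖ ≤ ‖z‖ := by
        have := hLn (e.symm z)
        rw [hz] at this
        refine le_of_sq_le_sq ?_ (norm_nonneg _)
        rw [this]
        have : 0 ≤ r ^ 2 * ‖((e.symm z : A.domain) : H)‖ ^ 2 := by positivity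
        linarith
      exact h1.trans (by gcongr)
    let K' : H →L[ℂ] H := LinearMap.mkContinuous K q hK
    have hK' : ‖-K'‖ < 1 := by
      rw [norm_neg]
      exact (LinearMap.mkContinuous_norm_le K hq₀ hK).trans_lt hq
    obtain ⟨u, hu⟩ := isUnit_one_sub_of_norm_lt_one hK'
    intro z
    let g : H := (↑u⁻¹ : H →L[ℂ] H) z
    have hg : g + K g = z := by
      have : ((u : H →L[ℂ] H) * (↑u⁻¹ : H →L[ℂ] H)) z = z := by simp
      rw [hu] at this
      simpa [g, K'] using this
    have hx := (e.symm g).2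
    have hx' := hTA.ge hx
    refine ⟨⟨(e.symm g : A.domain), hx'⟩, ?_⟩
    rw [hT _ hx (hTB hx'), ← hg]
    have hz : A (e.symm g) + (r * Complex.I) • ((e.symm g : A.domain) : H) = g :=
      e.apply_symm_apply g
    change A (e.symm g) + K g + _ = _
    rw [add_right_comm, hz]
  refine isSelfAdjoint_of_surjective (hTA ▸ hd) (fun x y ↦ ?_) (r * Complex.I) (hsurj r hr h₁) ?_
  · have hx : (x : H) ∈ A.domain := hTA ▸ x.2
    have hy : (y : H) ∈ A.domain := hTA ▸ y.2
    rw [hT x hx (hTB x.2), hT y hy (hTB y.2), inner_add_left, inner_add_right,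
      hA ⟨x, hx⟩ ⟨y, hy⟩, hB ⟨x, hTB x.2⟩ ⟨y, hTB y.2⟩]
  · have := hsurj (-r) (neg_ne_zero.2 hr) (fun z ↦ by simpa [sub_eq_add_neg] using h₂ z)
    simpa using this

end LinearPMap

/-! ### Potentials in weak `L³`: local square integrability and measurability -/

noncomputable section

namespace DiracLorentz

/-- The factor `2` makes the rearrangement at `t = (2c/s)³` strictly smaller than `s`. Hence some
admissible level lies below `s`, and the closed superlevel set is covered. -/
theorem measure_le_of_weakLorentzNorm_le {V : R3 → Matrix (Fin 4) (Fin 4) ℂ} {c : ℝ} (hc : 0 < c)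
    (hV : weakLorentzNorm 3 V ≤ ENNReal.ofReal c) {s : ℝ} (hs : 0 < s) :
    volume {x | s ≤ ‖matrixOp (V x)‖} ≤ ENNReal.ofReal ((2 * c / s) ^ 3) := by
  have ht : 0 < (2 * c / s) ^ 3 := by positivity
  have h := (le_iSup₂ (f := fun (t : ℝ) (_ : 0 < t) ↦ ENNReal.ofReal (t ^ (1 / (3 : ℝ))) *
    rearrangement (fun x ↦ ‖matrixOp (V x)‖ₑ) (ENNReal.ofReal t)) _ ht).trans hV
  rw [← Real.rpow_natCast, ← Real.rpow_mul (by positivity)] at h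
  norm_num at h
  have hlt : rearrangement (fun x ↦ ‖matrixOp (V x)‖ₑ)
      (ENNReal.ofReal ((2 * c / s) ^ 3)) < ENNReal.ofReal s := by
    by_contra! hle
    have h1 := (mul_le_mul_right hle (ENNReal.ofReal (2 * c / s))).trans h
    rw [← ENNReal.ofReal_mul (by positivity), div_mul_cancel₀ _ hs.ne',
      ENNReal.ofReal_le_ofReal_iff hc.le] at h1
    linarith
  obtain ⟨r, ⟨-, hr⟩, hrs⟩ := sInf_lt_iff.1 hlt
  refine (measure_mono fun x hx ↦ ?_).trans hr
  have : ENNReal.ofReal s ≤ ‖matrixOp (V x)‖ₑ := by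
    rw [← ofReal_norm]
    exact ENNReal.ofReal_le_ofReal hx
  exact hrs.trans_le this

/-- A function in weak `L³` is square integrable on sets of finite measure. -/
theorem setLIntegral_sq_le_of_measure_le {f : R3 → ℝ} (hf : AEMeasurable f volume)
    (hf₀ : ∀ x, 0 ≤ f x) {K : ℝ} (hK : 0 < K)
    (h : ∀ s, 0 < s → volume {x | s ≤ f x} ≤ ENNReal.ofReal ((K / s) ^ 3))
    {E : Set R3} (hE : volume E ≠ ∞) :
    ∫⁻ x in E, ENNReal.ofReal (f x ^ 2) ≤
      ENNReal.ofReal (9 * K ^ 2) * volume E ^ (1 / 3 : ℝ) := by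
  rcases eq_or_ne (volume E) 0 with h0 | h0
  · rw [setLIntegral_measure_zero _ _ h0]
    exact zero_le
  set b : ℝ := (volume E).toReal ^ (1 / 3 : ℝ) with hb
  have ha : 0 < (volume E).toReal := ENNReal.toReal_pos h0 hE
  have hb0 : 0 < b := by positivity
  have hb3 : b ^ 3 = (volume E).toReal := by
    rw [hb, ← Real.rpow_natCast, ← Real.rpow_mul ha.le]
    norm_num
  have hvol : volume E = ENNReal.ofReal (b ^ 3) := by rw [hb3, ENNReal.ofReal_toReal hE]
  have hvol' : volume E ^ (1 / 3 : ℝ) = ENNReal.ofReal b := by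
    rw [hb, ← ENNReal.ofReal_rpow_of_pos ha, ENNReal.ofReal_toReal hE]
  -- This height balances the two contributions. Below `T` the integral is at most `T²|E| = K²b`;
  -- the layers `2^j T ≤ f < 2^(j+1) T` contribute `4K²b · 2^(-j)` each, hence `8K²b` together.
  set T : ℝ := K / b with hT
  have hT0 : 0 < T := by positivity
  have hpt : ∀ x, ENNReal.ofReal (f x ^ 2) ≤ ENNReal.ofReal (T ^ 2) + ∑' j : ℕ,
      {x | 2 ^ j * T ≤ f x}.indicator (fun _ ↦ ENNReal.ofReal (4 ^ (j + 1) * T ^ 2)) x := by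
    intro x
    rcases le_or_gt (f x) T with hx | hx
    · refine le_add_right (ENNReal.ofReal_le_ofReal ?_)
      have := hf₀ x
      gcongr
    · obtain ⟨j, hj₁, hj₂⟩ := exists_nat_pow_near (x := f x / T) (y := 2)
        ((one_le_div hT0).2 hx.le) one_lt_two
      rw [le_div_iff₀ hT0] at hj₁
      rw [div_lt_iff₀ hT0] at hj₂
      refine le_add_left (le_trans ?_ (ENNReal.le_tsum j))
      rw [Set.indicator_of_mem (show x ∈ {x | 2 ^ j * T ≤ f x} from hj₁)]
      apply ENNReal.ofReal_le_ofReal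
      calc f x ^ 2 ≤ (2 ^ (j + 1) * T) ^ 2 := by
            have := hf₀ x
            gcongr
        _ = 4 ^ (j + 1) * T ^ 2 := by
            rw [mul_pow, ← pow_mul, mul_comm (j + 1), pow_mul]
            norm_num
  have hms : ∀ j : ℕ, NullMeasurableSet {x | 2 ^ j * T ≤ f x} (volume.restrict E) := fun j ↦
    nullMeasurableSet_le aemeasurable_const hf.restrict
  calc ∫⁻ x in E, ENNReal.ofReal (f x ^ 2)
      ≤ ∫⁻ x in E, (ENNReal.ofReal (T ^ 2) + ∑' j : ℕ,
        {x | 2 ^ j * T ≤ f x}.indicator (fun _ ↦ ENNReal.ofReal (4 ^ (j + 1) * T ^ 2)) x) :=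
        lintegral_mono hpt
    _ = ENNReal.ofReal (T ^ 2) * volume E + ∑' j : ℕ, ENNReal.ofReal (4 ^ (j + 1) * T ^ 2) *
        volume.restrict E {x | 2 ^ j * T ≤ f x} := by
        rw [lintegral_add_left measurable_const, setLIntegral_const,
          lintegral_tsum fun j ↦ aemeasurable_const.indicator₀ (hms j)]
        simp_rw [lintegral_indicator_const₀ (hms _)]
    _ ≤ ENNReal.ofReal (T ^ 2) * volume E + ∑' j : ℕ,
        ENNReal.ofReal (4 * K ^ 3 / T * (1 / 2) ^ j) := by
        gcongr with j
        refine (mul_le_mul_right ((Measure.restrict_apply_le _ _).trans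
          (h (2 ^ j * T) (by positivity))) _).trans_eq ?_
        rw [← ENNReal.ofReal_mul (by positivity)]
        congr 1
        have h4 : (4 : ℝ) ^ j = 2 ^ j * 2 ^ j := by rw [← mul_pow]; norm_num
        rw [pow_succ, h4, one_div, inv_pow]
        field_simp
    _ = ENNReal.ofReal (9 * K ^ 2) * volume E ^ (1 / 3 : ℝ) := by
        rw [← ENNReal.ofReal_tsum_of_nonneg (fun j ↦ by positivity)
          (summable_geometric_two.mul_left _), tsum_mul_left, tsum_geometric_two, hvol', hvol,
          ← ENNReal.ofReal_mul (by positivity), ← ENNReal.ofReal_add (by positivity)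
          (by positivity), ← ENNReal.ofReal_mul (by positivity), hT]
        congr 1
        field_simp
        norm_num

theorem aestronglyMeasurable_matrixOp {V : R3 → Matrix (Fin 4) (Fin 4) ℂ}
    (hV : ∀ i j, AEMeasurable (fun x ↦ V x i j) volume) :
    AEStronglyMeasurable (fun x ↦ matrixOp (V x)) volume := by
  have h : (fun x ↦ matrixOp (V x)) =
      fun x ↦ ∑ i, ∑ j, V x i j • matrixOp (Matrix.single i j 1) := by
    ext1 x
    conv_lhs => rw [Matrix.matrix_eq_sum_single (V x)]
    simp only [matrixOp, map_sum, ← map_smul, Matrix.smul_single, smul_eq_mul, mul_one]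
  rw [h]
  exact Finset.aestronglyMeasurable_fun_sum _ fun i _ ↦
    Finset.aestronglyMeasurable_fun_sum _ fun j _ ↦
      (hV i j).aestronglyMeasurable.smul_const _

theorem aestronglyMeasurable_matrixOp_apply {V : R3 → Matrix (Fin 4) (Fin 4) ℂ}
    (hV : ∀ i j, AEMeasurable (fun x ↦ V x i j) volume) {g : R3 → Spinor}
    (hg : AEStronglyMeasurable g volume) :
    AEStronglyMeasurable (fun x ↦ matrixOp (V x) (g x)) volume :=
  isBoundedBilinearMap_apply.continuous.comp_aestronglyMeasurable
    ((aestronglyMeasurable_matrixOp hV).prodMk hg)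

theorem toTemperedDistribution_add (f g : L2) :
    ((f + g : L2) : 𝓢'(R3, Spinor)) = (f : 𝓢'(R3, Spinor)) + g := by
  simp only [← Lp.toTemperedDistributionCLM_apply, map_add]

/-! ### Approximation in `H¹` by Schwartz functions -/

theorem toTemperedDistribution_smul (c : ℂ) (f : L2) :
    ((c • f : L2) : 𝓢'(R3, Spinor)) = c • (f : 𝓢'(R3, Spinor)) := by
  simp only [← Lp.toTemperedDistributionCLM_apply, map_smul]

/-- A continuous operator on tempered distributions that maps `L²` into itself is bounded
on `L²`, by the closed graph theorem. -/
theorem exists_clm_of_forall_exists (T : 𝓢'(R3, Spinor) →L[ℂ] 𝓢'(R3, Spinor))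
    (h : ∀ f : L2, ∃ g : L2, (g : 𝓢'(R3, Spinor)) = T f) :
    ∃ A : L2 →L[ℂ] L2, ∀ f : L2, (A f : 𝓢'(R3, Spinor)) = T f := by
  choose a ha using h
  let A : L2 →ₗ[ℂ] L2 :=
    { toFun := a
      map_add' := fun f g ↦ toTemperedDistribution_injective <| by
        rw [ha, toTemperedDistribution_add, toTemperedDistribution_add, map_add, ha, ha]
      map_smul' := fun c f ↦ toTemperedDistribution_injective <| by
        rw [ha, toTemperedDistribution_smul, RingHom.id_apply, toTemperedDistribution_smul,
          map_smul, ha] }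
  refine ⟨ContinuousLinearMap.ofSeqClosedGraph (g := A) ?_, fun f ↦ ha f⟩
  intro u x y hu hAu
  apply toTemperedDistribution_injective
  have hc := (Lp.toTemperedDistributionCLM Spinor (volume : Measure R3) 2).continuous
  have h1 := ((T.continuous.comp hc).tendsto x).comp hu
  have h2 := (hc.tendsto y).comp hAu
  refine tendsto_nhds_unique h2 (h1.congr fun n ↦ ?_) |>.trans ?_
  · exact (ha (u n)).symm
  · exact (ha x).symm

theorem mem_sobolevH1_iff {ψ : L2} :
    ψ ∈ sobolevH1 ↔ MemSobolev 1 2 (ψ : 𝓢'(R3, Spinor)) :=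
  Iff.rfl

theorem toLp_mem_sobolevH1 (f : 𝓢(R3, Spinor)) :
    (f.toLp 2 (volume : Measure R3) : L2) ∈ sobolevH1 := by
  have h : MemSobolev 1 2 (f : 𝓢'(R3, Spinor)) := f.memSobolev
  rw [mem_sobolevH1_iff, Lp.toTemperedDistribution_toLp_eq]
  exact h

/-- A Schwartz function as an element of `H¹`. -/
def schwartzH1 (f : 𝓢(R3, Spinor)) : sobolevH1 :=
  ⟨f.toLp 2 (volume : Measure R3), toLp_mem_sobolevH1 f⟩

theorem coe_schwartzH1 (f : 𝓢(R3, Spinor)) :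
    (schwartzH1 f : L2) = f.toLp 2 (volume : Measure R3) :=
  rfl

theorem weakDeriv_schwartzH1 (m : R3) (f : 𝓢(R3, Spinor)) :
    weakDeriv m (schwartzH1 f) = (∂_{m} f).toLp 2 (volume : Measure R3) := by
  apply toTemperedDistribution_injective
  rw [weakDeriv_spec, Lp.toTemperedDistribution_toLp_eq, coe_schwartzH1,
    Lp.toTemperedDistribution_toLp_eq, lineDerivOp_toTemperedDistributionCLM_eq]

/-- Schwartz functions are dense in `H¹`. -/
theorem exists_seq_schwartz_tendsto (ψ : sobolevH1) :
    ∃ f : ℕ → 𝓢(R3, Spinor),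
      Filter.Tendsto (fun n ↦ ((schwartzH1 (f n) : sobolevH1) : L2)) Filter.atTop (nhds ψ) ∧
      ∀ m, Filter.Tendsto (fun n ↦ weakDeriv m (schwartzH1 (f n))) Filter.atTop
        (nhds (weakDeriv m ψ)) := by
  -- Write `ψ = Jg` with `J` the Bessel potential of order `-1` and `g` in `L²`. Both `J` and `∂ₘJ`
  -- are bounded on `L²`, and `J` preserves Schwartz functions, so it suffices to approximate `g` in
  -- `L²`.
  obtain ⟨g, hg⟩ : MemSobolev 1 2 ((ψ : L2) : 𝓢'(R3, Spinor)) := ψ.2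
  rw [← besselPotential_neg_apply_eq_iff] at hg
  have hmem : ∀ u : L2, MemSobolev 1 2 (besselPotential R3 Spinor (-1) u) := by
    intro u
    rw [memSobolev_besselPotential_iff, neg_add_cancel, memSobolev_zero_iff]
    exact ⟨u, rfl⟩
  obtain ⟨A, hA⟩ := exists_clm_of_forall_exists (besselPotential R3 Spinor (-1)) fun u ↦ by
    obtain ⟨v, hv⟩ := memSobolev_zero_iff.1 ((hmem u).mono zero_le_one)
    exact ⟨v, hv.symm⟩
  have hd : ∀ m : R3, ∃ B : L2 →L[ℂ] L2, ∀ u : L2, (B u : 𝓢'(R3, Spinor)) =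
      (LineDeriv.lineDerivOpCLM ℂ 𝓢'(R3, Spinor) m ∘L besselPotential R3 Spinor (-1)) u := by
    intro m
    refine exists_clm_of_forall_exists _ fun u ↦ ?_
    have := (hmem u).lineDerivOp (m := m)
    rw [sub_self] at this
    obtain ⟨v, hv⟩ := memSobolev_zero_iff.1 this
    exact ⟨v, hv.symm⟩
  choose B hB using hd
  have hcl : g ∈ closure (Set.range (SchwartzMap.toLpCLM ℂ Spinor 2 (volume : Measure R3))) :=
    SchwartzMap.denseRange_toLpCLM (by simp) g
  obtain ⟨u, hu, hug⟩ := mem_closure_iff_seq_limit.1 hcl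
  choose v hv using hu
  have hs' : (fun x : R3 ↦ (((1 + ‖x‖ ^ 2) ^ ((-1 : ℝ) / 2) : ℝ) : ℂ)).HasTemperateGrowth := by
    fun_prop
  let w : ℕ → 𝓢(R3, Spinor) := fun n ↦ SchwartzMap.fourierMultiplierCLM Spinor
    (fun x : R3 ↦ (((1 + ‖x‖ ^ 2) ^ ((-1 : ℝ) / 2) : ℝ) : ℂ)) (v n)
  have hw : ∀ n, ((schwartzH1 (w n) : L2) : 𝓢'(R3, Spinor)) =
      besselPotential R3 Spinor (-1) (u n) := by
    intro n
    rw [coe_schwartzH1, Lp.toTemperedDistribution_toLp_eq, ← hv n, SchwartzMap.toLpCLM_apply,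
      Lp.toTemperedDistribution_toLp_eq, besselPotential,
      fourierMultiplierCLM_toTemperedDistributionCLM_eq hs']
  have hwA : ∀ n, (schwartzH1 (w n) : L2) = A (u n) := fun n ↦
    toTemperedDistribution_injective (by rw [hA, hw])
  have hψA : (ψ : L2) = A g := toTemperedDistribution_injective (by rw [hA, hg])
  refine ⟨w, ?_, fun m ↦ ?_⟩
  · simp_rw [hwA, hψA]
    exact (A.continuous.tendsto g).comp hug
  · have h1 : ∀ n, weakDeriv m (schwartzH1 (w n)) = B m (u n) := fun n ↦
      toTemperedDistribution_injective (by
        rw [weakDeriv_spec, hB, hw]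
        rfl)
    have h2 : weakDeriv m ψ = B m g := toTemperedDistribution_injective (by
        rw [weakDeriv_spec, hB, ← hg]
        rfl)
    simp_rw [h1, h2]
    exact ((B m).continuous.tendsto g).comp hug

/-! ### Weak derivatives and constant matrices -/

theorem inner_weakDeriv_schwartz (m : R3) (f g : 𝓢(R3, Spinor)) :
    inner ℂ (weakDeriv m (schwartzH1 f)) (schwartzH1 g : L2) =
      -inner ℂ (schwartzH1 f : L2) (weakDeriv m (schwartzH1 g)) := by
  rw [weakDeriv_schwartzH1, weakDeriv_schwartzH1, coe_schwartzH1, coe_schwartzH1,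
    SchwartzMap.inner_toL2_toL2_eq _ _ volume, SchwartzMap.inner_toL2_toL2_eq _ _ volume]
  have h := SchwartzMap.integral_bilinear_lineDerivOp_right_eq_neg_left (μ := volume) f g
    (isBoundedBilinearMap_inner (𝕜 := ℂ) (E := Spinor)).toContinuousLinearMap m
  simp only [IsBoundedBilinearMap.toContinuousLinearMap_apply] at h
  rw [h, neg_neg]

/-- Weak derivatives are skew-symmetric. -/
theorem inner_weakDeriv (m : R3) (φ ψ : sobolevH1) :
    inner ℂ (weakDeriv m φ) (ψ : L2) = -inner ℂ (φ : L2) (weakDeriv m ψ) := by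
  obtain ⟨f, hf, hf'⟩ := exists_seq_schwartz_tendsto φ
  obtain ⟨g, hg, hg'⟩ := exists_seq_schwartz_tendsto ψ
  refine tendsto_nhds_unique ((hf' m).inner hg) ?_
  simp_rw [inner_weakDeriv_schwartz]
  exact (hf.inner (hg' m)).neg

/-- The pointwise action of a matrix on `L²`. -/
abbrev matrixL2 (M : Matrix (Fin 4) (Fin 4) ℂ) : L2 →L[ℂ] L2 :=
  (matrixOp M).compLpL 2 (volume : Measure R3)

theorem coeFn_matrixL2 (M : Matrix (Fin 4) (Fin 4) ℂ) (ψ : L2) :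
    ∀ᵐ x, matrixL2 M ψ x = matrixOp M (ψ x) :=
  (matrixOp M).coeFn_compLpL ψ

theorem integrable_schwartz_smul (φ : 𝓢(R3, ℂ)) (ψ : L2) :
    Integrable (fun x ↦ φ x • ψ x) volume :=
  memLp_one_iff_integrable.1 ((Lp.memLp ψ).smul (φ.memLp 2 volume))

theorem toTemperedDistribution_matrixL2 (M : Matrix (Fin 4) (Fin 4) ℂ) (ψ : L2)
    (φ : 𝓢(R3, ℂ)) :
    (matrixL2 M ψ : 𝓢'(R3, Spinor)) φ = matrixOp M ((ψ : 𝓢'(R3, Spinor)) φ) := by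
  rw [Lp.toTemperedDistribution_apply, Lp.toTemperedDistribution_apply,
    ← ContinuousLinearMap.integral_comp_comm _ (integrable_schwartz_smul φ ψ)]
  refine integral_congr_ae ?_
  filter_upwards [coeFn_matrixL2 M ψ] with x hx
  rw [hx, map_smul]

/-- Spinor-valued distributions are tested against scalar functions. Fourier multipliers act on the
test function and the matrix on the value, so the two commute. -/
theorem matrixL2_mem_sobolevH1 (M : Matrix (Fin 4) (Fin 4) ℂ) (ψ : sobolevH1) :
    matrixL2 M ψ ∈ sobolevH1 := by
  obtain ⟨g, hg⟩ := mem_sobolevH1_iff.1 ψ.2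
  refine ⟨matrixL2 M g, ?_⟩
  ext1 φ
  rw [toTemperedDistribution_matrixL2, ← hg, besselPotential, fourierMultiplierCLM_apply_apply,
    fourierMultiplierCLM_apply_apply, toTemperedDistribution_matrixL2]

theorem weakDeriv_matrixL2 (M : Matrix (Fin 4) (Fin 4) ℂ) (m : R3) (ψ : sobolevH1) :
    weakDeriv m ⟨matrixL2 M ψ, matrixL2_mem_sobolevH1 M ψ⟩ = matrixL2 M (weakDeriv m ψ) := by
  apply toTemperedDistribution_injective
  ext1 φ
  rw [weakDeriv_spec, toTemperedDistribution_matrixL2, weakDeriv_spec,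
    lineDerivOp_apply_apply, lineDerivOp_apply_apply, toTemperedDistribution_matrixL2]

theorem weakDeriv_mem_sobolevH1 {u : sobolevH1}
    (hu : MemSobolev 2 2 ((u : L2) : 𝓢'(R3, Spinor))) (m : R3) : weakDeriv m u ∈ sobolevH1 := by
  rw [mem_sobolevH1_iff, weakDeriv_spec]
  have := hu.lineDerivOp (m := m)
  norm_num at this
  exact this

/-- Both derivatives are Fourier multipliers, and their scalar symbols commute. -/
theorem lineDerivOp_comm (m n : R3) (u : 𝓢'(R3, Spinor)) : ∂_{m} (∂_{n} u) = ∂_{n} (∂_{m} u) := by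
  have h (m : R3) : (fun x : R3 ↦ ((inner ℝ x m : ℝ) : ℂ)).HasTemperateGrowth := by fun_prop
  simp only [lineDeriv_eq_fourierMultiplierCLM, map_smul,
    fourierMultiplierCLM_fourierMultiplierCLM_apply (h _) (h _)]
  rw [mul_comm (fun x : R3 ↦ ((inner ℝ x m : ℝ) : ℂ))]

theorem weakDeriv_comm {u : sobolevH1} (hu : MemSobolev 2 2 ((u : L2) : 𝓢'(R3, Spinor)))
    (m n : R3) :
    weakDeriv m ⟨weakDeriv n u, weakDeriv_mem_sobolevH1 hu n⟩ =
      weakDeriv n ⟨weakDeriv m u, weakDeriv_mem_sobolevH1 hu m⟩ := by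
  apply toTemperedDistribution_injective
  simp only [weakDeriv_spec, lineDerivOp_comm m n]

theorem matrixL2_one (f : L2) : matrixL2 1 f = f := by
  apply Lp.ext
  filter_upwards [coeFn_matrixL2 1 f] with x hx
  simp [hx, matrixOp]

theorem matrixL2_mul (M N : Matrix (Fin 4) (Fin 4) ℂ) (f : L2) :
    matrixL2 (M * N) f = matrixL2 M (matrixL2 N f) := by
  apply Lp.ext
  filter_upwards [coeFn_matrixL2 (M * N) f, coeFn_matrixL2 M (matrixL2 N f),
    coeFn_matrixL2 N f] with x h₁ h₂ h₃
  rw [h₁, h₂, h₃, matrixOp, map_mul]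
  rfl

theorem matrixL2_neg (M : Matrix (Fin 4) (Fin 4) ℂ) (f : L2) :
    matrixL2 (-M) f = -matrixL2 M f := by
  apply Lp.ext
  filter_upwards [coeFn_matrixL2 (-M) f, coeFn_matrixL2 M f,
    Lp.coeFn_neg (matrixL2 M f)] with x h₁ h₂ h₃
  rw [h₁, h₃, Pi.neg_apply, h₂, matrixOp, map_neg]
  rfl

theorem inner_matrixOp {M : Matrix (Fin 4) (Fin 4) ℂ} (hM : M.IsHermitian) (v w : Spinor) :
    inner ℂ (matrixOp M v) w = inner ℂ v (matrixOp M w) := by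
  rw [← ContinuousLinearMap.adjoint_inner_right, ← ContinuousLinearMap.star_eq_adjoint,
    matrixOp, ← map_star, Matrix.star_eq_conjTranspose, hM.eq]

theorem inner_matrixL2 {M : Matrix (Fin 4) (Fin 4) ℂ} (hM : M.IsHermitian) (f g : L2) :
    inner ℂ (matrixL2 M f) g = inner ℂ f (matrixL2 M g) := by
  refine integral_congr_ae ?_
  filter_upwards [coeFn_matrixL2 M f, coeFn_matrixL2 M g] with x h₁ h₂
  rw [h₁, h₂, inner_matrixOp hM]

/-! ### The Clifford relations and the free Dirac operator -/

theorem isHermitian_diracMatrix (k : Fin 3) : (diracMatrix k).IsHermitian := by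
  fin_cases k <;> ext i j <;> fin_cases i <;> fin_cases j <;> simp [diracMatrix]

theorem diracMatrix_mul_self (k : Fin 3) : diracMatrix k * diracMatrix k = 1 := by
  fin_cases k <;> ext i j <;> fin_cases i <;> fin_cases j <;>
    simp [diracMatrix, Matrix.mul_apply, Fin.sum_univ_four]

/-- The restriction `j < k` orients the relation as a rewrite rule that puts the smaller index
first. -/
theorem diracMatrix_anticomm {j k : Fin 3} (h : j < k) :
    diracMatrix k * diracMatrix j = -(diracMatrix j * diracMatrix k) := by
  fin_cases j <;> fin_cases k <;> first | exact absurd h (by decide) | skip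
  all_goals
    ext a b
    fin_cases a <;> fin_cases b <;>
      simp [diracMatrix, Matrix.mul_apply, Fin.sum_univ_four]

/-- The partial derivative `∂ₖ` from `H¹` to `L²`. -/
abbrev partialDeriv (k : Fin 3) : sobolevH1 →ₗ[ℂ] L2 :=
  weakDeriv (EuclideanSpace.single k 1)

theorem freeDirac_apply (ψ : sobolevH1) :
    freeDirac ψ = (1 / Complex.I) • ∑ k, matrixL2 (diracMatrix k) (partialDeriv k ψ) := by
  change ((1 / Complex.I) • ∑ k : Fin 3, ((matrixL2 (diracMatrix k)).toLinearMap ∘ₗ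
    partialDeriv k)) ψ = _
  rw [LinearMap.smul_apply, LinearMap.sum_apply]
  rfl

/-- The free Dirac operator is symmetric. -/
theorem inner_freeDirac (φ ψ : sobolevH1) :
    inner ℂ (freeDirac φ) (ψ : L2) = inner ℂ (φ : L2) (freeDirac ψ) := by
  rw [freeDirac_apply, freeDirac_apply, inner_smul_left, inner_smul_right, sum_inner, inner_sum,
    Finset.mul_sum, Finset.mul_sum]
  refine Finset.sum_congr rfl fun k _ ↦ ?_
  rw [inner_matrixL2 (isHermitian_diracMatrix k), ← inner_matrixL2 (isHermitian_diracMatrix k)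
    φ.1 _]
  have h₁ := inner_weakDeriv (EuclideanSpace.single k 1) φ
    ⟨matrixL2 (diracMatrix k) ψ, matrixL2_mem_sobolevH1 _ ψ⟩
  rw [weakDeriv_matrixL2] at h₁
  rw [h₁, inner_matrixL2 (isHermitian_diracMatrix k)]
  simp

/-- The pointwise action of a matrix on `H¹`. -/
def matrixH1 (M : Matrix (Fin 4) (Fin 4) ℂ) (ψ : sobolevH1) : sobolevH1 :=
  ⟨matrixL2 M ψ, matrixL2_mem_sobolevH1 M ψ⟩

/-- The partial derivative of an `H²` function, as an element of `H¹`. -/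
def partialDerivH1 {u : sobolevH1}
    (hu : MemSobolev 2 2 ((u : L2) : 𝓢'(R3, Spinor))) (k : Fin 3) : sobolevH1 :=
  ⟨partialDeriv k u, weakDeriv_mem_sobolevH1 hu _⟩

/-- The free Dirac operator maps `H²` to `H¹`. -/
def freeDiracH1 {u : sobolevH1}
    (hu : MemSobolev 2 2 ((u : L2) : 𝓢'(R3, Spinor))) : sobolevH1 :=
  (1 / Complex.I) • ∑ k, matrixH1 (diracMatrix k) (partialDerivH1 hu k)

theorem coe_freeDiracH1 {u : sobolevH1}
    (hu : MemSobolev 2 2 ((u : L2) : 𝓢'(R3, Spinor))) : (freeDiracH1 hu : L2) = freeDirac u := by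
  rw [freeDirac_apply, freeDiracH1, Submodule.coe_smul, Submodule.coe_sum]
  rfl

/-- The square of the free Dirac operator is minus the Laplacian. -/
theorem freeDirac_freeDiracH1 {u : sobolevH1}
    (hu : MemSobolev 2 2 ((u : L2) : 𝓢'(R3, Spinor))) :
    freeDirac (freeDiracH1 hu) = -∑ k, partialDeriv k (partialDerivH1 hu k) := by
  have hc : ∀ j k, partialDeriv j (partialDerivH1 hu k) = partialDeriv k (partialDerivH1 hu j) :=
    fun j k ↦ weakDeriv_comm hu _ _
  have hd : ∀ j, partialDeriv j (freeDiracH1 hu) = (1 / Complex.I) •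
      ∑ k, matrixL2 (diracMatrix k) (partialDeriv j (partialDerivH1 hu k)) := by
    intro j
    rw [freeDiracH1, map_smul, map_sum]
    congr 1
    exact Finset.sum_congr rfl fun k _ ↦ weakDeriv_matrixL2 _ _ _
  have hsq : (1 / Complex.I) * (1 / Complex.I) = -1 := by
    rw [one_div, Complex.inv_I, neg_mul_neg, Complex.I_mul_I]
  simp only [freeDirac_apply, hd, map_smul, map_sum, ← Finset.smul_sum, smul_smul, hsq]
  -- The diagonal terms give the Laplacian. Off the diagonal, anticommuting matrices meet commuting
  -- derivatives, and the terms cancel in pairs.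
  simp only [← matrixL2_mul, Fin.sum_univ_three, diracMatrix_mul_self, matrixL2_one,
    diracMatrix_anticomm (show (0 : Fin 3) < 1 by decide),
    diracMatrix_anticomm (show (0 : Fin 3) < 2 by decide),
    diracMatrix_anticomm (show (1 : Fin 3) < 2 by decide), matrixL2_neg,
    hc 1 0, hc 2 0, hc 2 1]
  module

/-- Symmetry turns the left side into `⟨u, 𝒟²u⟩ = -∑ ⟨u, ∂ₖ∂ₖu⟩`, and skew-symmetry of `∂ₖ` moves
one derivative back. The `H²` assumption ensures that `𝒟u` is again in the domain. -/
theorem inner_freeDirac_freeDirac_of_memSobolev {u : sobolevH1}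
    (hu : MemSobolev 2 2 ((u : L2) : 𝓢'(R3, Spinor))) :
    inner ℂ (freeDirac u) (freeDirac u) = ∑ k, inner ℂ (partialDeriv k u) (partialDeriv k u) := by
  have h := inner_freeDirac u (freeDiracH1 hu)
  rw [coe_freeDiracH1, freeDirac_freeDiracH1, inner_neg_right, inner_sum] at h
  rw [h, ← Finset.sum_neg_distrib]
  refine Finset.sum_congr rfl fun k _ ↦ ?_
  exact (inner_weakDeriv (EuclideanSpace.single k 1) u (partialDerivH1 hu k)).symm

theorem inner_freeDirac_freeDirac (ψ : sobolevH1) :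
    inner ℂ (freeDirac ψ) (freeDirac ψ) = ∑ k, inner ℂ (partialDeriv k ψ) (partialDeriv k ψ) := by
  obtain ⟨f, -, hf⟩ := exists_seq_schwartz_tendsto ψ
  have hD : Filter.Tendsto (fun n ↦ freeDirac (schwartzH1 (f n))) Filter.atTop
      (nhds (freeDirac ψ)) := by
    simp_rw [freeDirac_apply]
    refine Filter.Tendsto.const_smul (tendsto_finsetSum _ fun k _ ↦ ?_) _
    exact ((matrixL2 (diracMatrix k)).continuous.tendsto _).comp (hf _)
  have hm : ∀ n, MemSobolev 2 2 ((schwartzH1 (f n) : L2) : 𝓢'(R3, Spinor)) := by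
    intro n
    rw [coe_schwartzH1, Lp.toTemperedDistribution_toLp_eq]
    exact (f n).memSobolev
  refine tendsto_nhds_unique (hD.inner hD) ?_
  simp_rw [inner_freeDirac_freeDirac_of_memSobolev (hm _)]
  exact tendsto_finsetSum _ fun k _ ↦ (hf _).inner (hf _)

theorem norm_partialDeriv_le (k : Fin 3) (ψ : sobolevH1) :
    ‖partialDeriv k ψ‖ ≤ ‖freeDirac ψ‖ := by
  have h := congrArg (RCLike.re : ℂ → ℝ) (inner_freeDirac_freeDirac ψ)
  simp only [inner_self_eq_norm_sq, map_sum] at h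
  refine le_of_sq_le_sq ?_ (norm_nonneg _)
  rw [h]
  exact Finset.single_le_sum (f := fun k ↦ ‖partialDeriv k ψ‖ ^ 2) (fun _ _ ↦ by positivity)
    (Finset.mem_univ k)

/-! ### Resolvent of the free Dirac operator -/

open Real in
-- With the Fourier kernel `e^{-2πi x·ξ}`, `-Δ` has the symbol `4π²|ξ|²`, so `1 + |ξ|²` is the
-- symbol of `1 - Δ/(4π²)`. This is what singles out the spectral parameters `±2πi`.
theorem besselPotential_two_apply (u : 𝓢'(R3, Spinor)) :
    besselPotential R3 Spinor 2 u = u - ((2 * (π : ℂ)) ^ 2)⁻¹ •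
      ∑ k : Fin 3, ∂_{EuclideanSpace.single k (1 : ℝ)} (∂_{EuclideanSpace.single k (1 : ℝ)} u) := by
  have h₁ : (fun _ : R3 ↦ (1 : ℂ)).HasTemperateGrowth := by fun_prop
  have h₂ : (fun x : R3 ↦ ((‖x‖ ^ 2 : ℝ) : ℂ)).HasTemperateGrowth := by fun_prop
  have hsum : (fun x : R3 ↦ (((1 + ‖x‖ ^ 2) ^ ((2 : ℝ) / 2) : ℝ) : ℂ)) =
      (fun _ ↦ (1 : ℂ)) + fun x : R3 ↦ ((‖x‖ ^ 2 : ℝ) : ℂ) := by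
    ext x
    simp
  have hb := laplacian_eq_sum (EuclideanSpace.basisFun (Fin 3) ℝ) u
  simp only [EuclideanSpace.basisFun_apply] at hb
  rw [← hb, laplacian_eq_fourierMultiplierCLM, besselPotential, hsum, fourierMultiplierCLM_apply,
    smulLeftCLM_add h₁ h₂, _root_.add_apply, FourierTransform.fourierInv_add, smulLeftCLM_const,
    one_smul, FourierTransform.fourierInv_fourier_eq, ← fourierMultiplierCLM_apply, ← Complex.coe_smul, smul_smul]
  have hπ : ((2 * (π : ℂ)) ^ 2)⁻¹ * ((-(2 * π) ^ 2 : ℝ) : ℂ) = -1 := by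
    have : (π : ℂ) ≠ 0 := Complex.ofReal_ne_zero.2 pi_ne_zero
    push_cast
    field_simp
  rw [hπ, neg_one_smul, sub_neg_eq_add]

open Real in
/-- The resolvent equation `(𝒟 + c) ψ = g` with `c = ± 2πi` has a solution in `H¹`. -/
theorem exists_freeDirac_add_smul_eq {c : ℂ} (hc : c ^ 2 = -(2 * π) ^ 2) (g : L2) :
    ∃ ψ : sobolevH1, freeDirac ψ + c • (ψ : L2) = g := by
  have hmem : MemSobolev 2 2 (besselPotential R3 Spinor (-2) g) := by
    rw [memSobolev_besselPotential_iff, neg_add_cancel, memSobolev_zero_iff]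
    exact ⟨g, rfl⟩
  obtain ⟨v, hv⟩ := memSobolev_zero_iff.1 (hmem.mono zero_le_two)
  rw [hv] at hmem
  have hv1 : v ∈ sobolevH1 := hmem.mono one_le_two
  let u : sobolevH1 := ⟨v, hv1⟩
  have hu : MemSobolev 2 2 ((u : L2) : 𝓢'(R3, Spinor)) := hmem
  have hlap : g = (u : L2) - ((2 * (π : ℂ)) ^ 2)⁻¹ • ∑ k, partialDeriv k (partialDerivH1 hu k) := by
    apply toTemperedDistribution_injective
    have h := besselPotential_two_apply ((u : L2) : 𝓢'(R3, Spinor))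
    rw [show ((u : L2) : 𝓢'(R3, Spinor)) = _ from hv.symm, besselPotential_besselPotential_apply,
      neg_add_cancel, besselPotential_zero, hv] at h
    refine h.trans ?_
    simp only [← Lp.toTemperedDistributionCLM_apply, map_sub, map_sum,
      map_smul]
    simp only [Lp.toTemperedDistributionCLM_apply, weakDeriv_spec, partialDerivH1]
    rfl
  -- The solution is `(2π)⁻² (𝒟 - c) u` with `u - Δu/(4π²) = g`, because `(𝒟 + c)(𝒟 - c) = -Δ +
  -- 4π²`.
  refine ⟨((2 * (π : ℂ)) ^ 2)⁻¹ • (freeDiracH1 hu - c • u), ?_⟩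
  have hr : ∀ (r : ℂ) (φ : sobolevH1), freeDirac (r • φ) = r • freeDirac φ := fun r φ ↦
    LinearPMap.map_smul freeDirac r φ
  have hs : freeDirac (freeDiracH1 hu - c • u) =
      freeDirac (freeDiracH1 hu) - c • freeDirac u := by
    have h := LinearPMap.map_sub freeDirac (freeDiracH1 hu) (c • u)
    exact h.trans (congrArg _ (hr c u))
  have hcoe : ((((2 * (π : ℂ)) ^ 2)⁻¹ • (freeDiracH1 hu - c • u) : sobolevH1) : L2) =
      ((2 * (π : ℂ)) ^ 2)⁻¹ • (freeDirac u - c • (u : L2)) := by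
    rw [← coe_freeDiracH1 hu]
    rfl
  rw [hr, hs, freeDirac_freeDiracH1, hcoe, hlap]
  generalize ∑ k, partialDeriv k (partialDerivH1 hu k) = Δ
  have hπ : ((2 * (π : ℂ)) ^ 2)⁻¹ • (c ^ 2) • (u : L2) = -(u : L2) := by
    have : (π : ℂ) ≠ 0 := Complex.ofReal_ne_zero.2 pi_ne_zero
    rw [hc, smul_smul, mul_neg, inv_mul_cancel₀ (by simp), neg_one_smul]
  rw [eq_neg_iff_add_eq_zero] at hπ
  rw [← sub_eq_zero, ← neg_eq_zero, ← hπ]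
  module

/-! ### Truncation and the Sobolev inequality on level sets -/

/-- The derivative of the smooth transition function is bounded, and it vanishes outside
`(0, 1)`. -/
theorem exists_abs_deriv_smoothTransition_le :
    ∃ M : ℝ, 0 < M ∧ ∀ t, |deriv Real.smoothTransition t| ≤ M ∧
      (t ≤ 0 ∨ 1 ≤ t → deriv Real.smoothTransition t = 0) := by
  have hz : ∀ t, t ≤ 0 ∨ 1 ≤ t → deriv Real.smoothTransition t = 0 := by
    -- Outside `(0, 1)` the transition function attains its global minimum `0` or maximum `1`, so
    -- its derivative vanishes there.
    rintro t (ht | ht)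
    · refine IsLocalMin.deriv_eq_zero (Filter.Eventually.of_forall fun s ↦ ?_)
      rw [Real.smoothTransition.zero_of_nonpos ht]
      exact Real.smoothTransition.nonneg s
    · refine IsLocalMax.deriv_eq_zero (Filter.Eventually.of_forall fun s ↦ ?_)
      rw [Real.smoothTransition.one_of_one_le ht]
      exact Real.smoothTransition.le_one s
  have hc : Continuous (deriv Real.smoothTransition) :=
    (Real.smoothTransition.contDiff (n := 1)).continuous_deriv le_rfl
  obtain ⟨M, hM⟩ := isCompact_Icc.exists_bound_of_continuousOn (s := Set.Icc (0 : ℝ) 1)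
    hc.continuousOn
  refine ⟨max M 1, by positivity, fun t ↦ ⟨?_, hz t⟩⟩
  by_cases ht : t ∈ Set.Icc (0 : ℝ) 1
  · exact (hM t ht).trans (le_max_left _ _)
  · rw [hz t, abs_zero]
    · positivity
    · by_contra! h
      exact ht ⟨h.1.le, h.2.le⟩

/-- A smooth cutoff of the size of `f`, equal to `0` where `‖f‖ ≤ s` and to `1` where
`2 * s ≤ ‖f‖`. -/
def normCutoff (s : ℝ) (f : R3 → Spinor) (x : R3) : ℝ :=
  Real.smoothTransition ((‖f x‖ ^ 2 / s ^ 2 - 1) / 3)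

theorem normCutoff_eq_zero {s : ℝ} (hs : 0 < s) {f : R3 → Spinor} {x : R3} (hx : ‖f x‖ ≤ s) :
    normCutoff s f x = 0 := by
  apply Real.smoothTransition.zero_of_nonpos
  have : ‖f x‖ ^ 2 / s ^ 2 ≤ 1 := by
    rw [div_le_one (by positivity)]
    gcongr
  linarith

theorem normCutoff_eq_one {s : ℝ} (hs : 0 < s) {f : R3 → Spinor} {x : R3}
    (hx : 2 * s ≤ ‖f x‖) : normCutoff s f x = 1 := by
  apply Real.smoothTransition.one_of_one_le
  have : 4 ≤ ‖f x‖ ^ 2 / s ^ 2 := by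
    rw [le_div_iff₀ (by positivity)]
    calc 4 * s ^ 2 = (2 * s) ^ 2 := by ring
      _ ≤ _ := by gcongr
  linarith

/-- The cutoff depends on `‖f‖²`, which unlike `‖f‖` is smooth at the zeros of `f`. -/
theorem contDiff_normCutoff (s : ℝ) (f : 𝓢(R3, Spinor)) : ContDiff ℝ 1 (normCutoff s f) := by
  unfold normCutoff
  have h : ContDiff ℝ 1 fun x ↦ ‖f x‖ ^ 2 := (f.smooth 1).norm_sq ℂ
  exact Real.smoothTransition.contDiff.comp (((h.div_const _).sub contDiff_const).div_const _)

theorem exists_isCompact_le_norm (f : 𝓢(R3, Spinor)) {s : ℝ} (hs : 0 < s) :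
    ∃ K : Set R3, IsCompact K ∧ {x | s ≤ ‖f x‖} ⊆ K := by
  have h := f.tendsto_cocompact.norm
  rw [norm_zero] at h
  obtain ⟨K, hK, hK'⟩ := Filter.mem_cocompact.1 (h.eventually_lt_const hs)
  refine ⟨K, hK, fun x hx ↦ ?_⟩
  by_contra hxK
  have : ‖f x‖ < s := hK' hxK
  exact (not_lt.2 hx) this

theorem hasCompactSupport_normCutoff {s : ℝ} (hs : 0 < s) (f : 𝓢(R3, Spinor)) :
    HasCompactSupport (normCutoff s f) := by
  obtain ⟨K, hK, hK'⟩ := exists_isCompact_le_norm f hs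
  refine HasCompactSupport.intro hK fun x hx ↦ normCutoff_eq_zero hs ?_
  by_contra! h
  exact hx (hK' h.le)

theorem norm_fderiv_norm_sq_le (f : 𝓢(R3, Spinor)) (x : R3) :
    ‖fderiv ℝ (fun x ↦ ‖f x‖ ^ 2) x‖ ≤ 2 * ‖f x‖ * ‖fderiv ℝ f x‖ := by
  have hf := f.hasFDerivAt x
  have h := (Complex.reCLM.hasFDerivAt.comp x (hf.inner ℂ hf))
  have he : (fun x ↦ ‖f x‖ ^ 2) = Complex.reCLM ∘ fun x ↦ inner ℂ (f x) (f x) := by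
    ext x
    exact (inner_self_eq_norm_sq (𝕜 := ℂ) (f x)).symm
  rw [he, h.fderiv]
  refine ContinuousLinearMap.opNorm_le_bound _ (by positivity) fun v ↦ ?_
  simp only [ContinuousLinearMap.comp_apply, ContinuousLinearMap.prod_apply, fderivInnerCLM_apply]
  refine (Complex.abs_re_le_norm _).trans ((norm_add_le _ _).trans ?_)
  have h₁ := (fderiv ℝ f x).le_opNorm v
  have h₂ := norm_inner_le_norm (𝕜 := ℂ) (f x) (fderiv ℝ f x v)
  have h₃ := norm_inner_le_norm (𝕜 := ℂ) (fderiv ℝ f x v) (f x)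
  have h₄ := mul_le_mul_of_nonneg_left h₁ (norm_nonneg (f x))
  linarith

/-- By the chain rule the gradient is at most a constant times `s⁻² ‖f‖ ‖∇f‖`, and `‖f‖ ≤ 2s` on the
shell leaves a factor `1/s`. Off the shell the transition function has zero derivative. -/
theorem exists_norm_fderiv_normCutoff_le :
    ∃ M : ℝ, 0 < M ∧ ∀ (f : 𝓢(R3, Spinor)) (s : ℝ), 0 < s → ∀ x,
      ‖fderiv ℝ (normCutoff s f) x‖ ≤
        M / s * {x | s < ‖f x‖ ∧ ‖f x‖ ≤ 2 * s}.indicator (fun x ↦ ‖fderiv ℝ f x‖) x := by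
  obtain ⟨M, hM0, hM⟩ := exists_abs_deriv_smoothTransition_le
  refine ⟨4 * M, by positivity, fun f s hs x ↦ ?_⟩
  have hsq : DifferentiableAt ℝ (fun x ↦ ‖f x‖ ^ 2) x :=
    ((f.smooth 1).norm_sq ℂ).differentiable one_ne_zero x
  have hin : HasFDerivAt (fun x ↦ (‖f x‖ ^ 2 / s ^ 2 - 1) / 3)
      ((3 : ℝ)⁻¹ • ((s ^ 2)⁻¹ • fderiv ℝ (fun x ↦ ‖f x‖ ^ 2) x)) x := by
    simpa only [div_eq_mul_inv] using
      ((hsq.hasFDerivAt.mul_const (s ^ 2)⁻¹).sub_const 1).mul_const (3 : ℝ)⁻¹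
  have hst : HasDerivAt Real.smoothTransition
      (deriv Real.smoothTransition ((‖f x‖ ^ 2 / s ^ 2 - 1) / 3))
      ((‖f x‖ ^ 2 / s ^ 2 - 1) / 3) :=
    ((Real.smoothTransition.contDiff (n := 1)).differentiable one_ne_zero _).hasDerivAt
  have hd : HasFDerivAt (normCutoff s f) _ x := hst.comp_hasFDerivAt x hin
  obtain ⟨h₁, h₂⟩ := hM ((‖f x‖ ^ 2 / s ^ 2 - 1) / 3)
  rw [hd.fderiv]
  by_cases hx : s < ‖f x‖ ∧ ‖f x‖ ≤ 2 * s
  · rw [Set.indicator_of_mem (show x ∈ {x | s < ‖f x‖ ∧ ‖f x‖ ≤ 2 * s} from hx)]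
    have h₃ := norm_fderiv_norm_sq_le f x
    rw [norm_smul, norm_smul, norm_smul, Real.norm_eq_abs, norm_inv, norm_inv,
      Real.norm_of_nonneg (sq_nonneg s)]
    calc _ ≤ M * (‖(3 : ℝ)‖⁻¹ * ((s ^ 2)⁻¹ * (2 * (2 * s) * ‖fderiv ℝ f x‖))) := by
          gcongr
          refine h₃.trans ?_
          gcongr
          exact hx.2
      _ = 4 * M / s * ‖fderiv ℝ f x‖ * (1 / 3) := by
          rw [Real.norm_of_nonneg (by norm_num)]
          field_simp
          ring
      _ ≤ 4 * M / s * ‖fderiv ℝ f x‖ := by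
          refine mul_le_of_le_one_right (by positivity) (by norm_num)
  · rw [Set.indicator_of_notMem (show x ∉ {x | s < ‖f x‖ ∧ ‖f x‖ ≤ 2 * s} from hx), mul_zero, h₂,
      zero_smul, norm_zero]
    rcases not_and_or.1 hx with h | h
    · left
      have : ‖f x‖ ^ 2 / s ^ 2 ≤ 1 := by
        rw [div_le_one (by positivity)]
        gcongr
        exact not_lt.1 h
      linarith
    · right
      have : 4 ≤ ‖f x‖ ^ 2 / s ^ 2 := by
        rw [le_div_iff₀ (by positivity)]
        calc 4 * s ^ 2 = (2 * s) ^ 2 := by ring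
          _ ≤ _ := by
            have := not_le.1 h
            gcongr
      linarith

theorem eLpNorm_two_sq {E : Type*} [NormedAddCommGroup E] (f : R3 → E) :
    eLpNorm f 2 volume ^ 2 = ∫⁻ x, ENNReal.ofReal (‖f x‖ ^ 2) := by
  have h := eLpNorm_nnreal_pow_eq_lintegral (f := f) (μ := (volume : Measure R3)) (p := 2)
    (by norm_num)
  simp only [ENNReal.coe_ofNat, NNReal.coe_ofNat, ENNReal.rpow_ofNat] at h
  rw [h]
  refine lintegral_congr fun x ↦ ?_
  rw [ENNReal.ofReal_pow (norm_nonneg _), ofReal_norm]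

/-- The Sobolev inequality, localized to the level sets of a function. -/
theorem exists_levelSet_sobolev :
    ∃ C : ℝ, 0 < C ∧ ∀ (f : 𝓢(R3, Spinor)) (s : ℝ), 0 < s →
      ENNReal.ofReal (s ^ 2) * volume {x | 2 * s ≤ ‖f x‖} ^ (1 / 3 : ℝ) ≤ ENNReal.ofReal C *
        ∫⁻ x in {x | s < ‖f x‖ ∧ ‖f x‖ ≤ 2 * s}, ENNReal.ofReal (‖fderiv ℝ f x‖ ^ 2) := by
  obtain ⟨M, hM0, hM⟩ := exists_norm_fderiv_normCutoff_le
  let S : ℝ := SNormLESNormFDerivOfEqConst ℝ (volume : Measure R3) 2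
  -- The summand `1` only serves to make the constant positive.
  refine ⟨(S * M) ^ 2 + 1, by positivity, fun f s hs ↦ ?_⟩
  have hsob := eLpNorm_le_eLpNorm_fderiv_of_eq (volume : Measure R3) (contDiff_normCutoff s f)
    (hasCompactSupport_normCutoff hs f) (p := 2) (p' := 6) (by norm_num) (by simp)
    (by simp; norm_num)
  set A : Set R3 := {x | s < ‖f x‖ ∧ ‖f x‖ ≤ 2 * s} with hA
  have hAm : MeasurableSet A :=
    (measurableSet_lt measurable_const f.continuous.norm.measurable).inter
      (measurableSet_le f.continuous.norm.measurable measurable_const)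
  have hD : eLpNorm (fderiv ℝ (normCutoff s f)) 2 volume ^ 2 ≤
      ENNReal.ofReal ((M / s) ^ 2) * ∫⁻ x in A, ENNReal.ofReal (‖fderiv ℝ f x‖ ^ 2) := by
    rw [eLpNorm_two_sq, ← lintegral_indicator hAm, ← lintegral_const_mul' _ _ (by simp)]
    refine lintegral_mono fun x ↦ ?_
    refine (ENNReal.ofReal_le_ofReal (pow_le_pow_left₀ (norm_nonneg _) (hM f s hs x) 2)).trans ?_
    by_cases hx : x ∈ A
    · rw [Set.indicator_of_mem hx, Set.indicator_of_mem hx, mul_pow,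
        ENNReal.ofReal_mul (by positivity)]
    · rw [Set.indicator_of_notMem hx]
      simp
  -- Chebyshev's inequality in `L⁶`, the Sobolev exponent of `L²` gradients in dimension three: the
  -- cutoff equals `1` on this set.
  have hvol : volume {x | 2 * s ≤ ‖f x‖} ^ (1 / 3 : ℝ) ≤
      eLpNorm (normCutoff s f) 6 volume ^ 2 := by
    have h := mul_meas_ge_le_pow_eLpNorm' (volume : Measure R3) (p := 6) (by norm_num)
      (by norm_num) (contDiff_normCutoff s f).continuous.aestronglyMeasurable 1
    rw [ENNReal.one_rpow, one_mul] at h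
    have hle : volume {x | 2 * s ≤ ‖f x‖} ≤ eLpNorm (normCutoff s f) 6 volume ^ (6 : ℝ) := by
      refine (measure_mono fun x hx ↦ ?_).trans h
      have : normCutoff s f x = 1 := normCutoff_eq_one hs hx
      simp [this]
    refine (ENNReal.rpow_le_rpow hle (by norm_num)).trans_eq ?_
    rw [← ENNReal.rpow_mul, ← ENNReal.rpow_natCast]
    norm_num
  have hsob' : eLpNorm (normCutoff s f) 6 volume ≤
      ENNReal.ofReal S * eLpNorm (fderiv ℝ (normCutoff s f)) 2 volume := by
    rw [ENNReal.ofReal_coe_nnreal]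
    exact hsob
  calc ENNReal.ofReal (s ^ 2) * volume {x | 2 * s ≤ ‖f x‖} ^ (1 / 3 : ℝ)
      ≤ ENNReal.ofReal (s ^ 2) * (ENNReal.ofReal S ^ 2 * (ENNReal.ofReal ((M / s) ^ 2) *
        ∫⁻ x in A, ENNReal.ofReal (‖fderiv ℝ f x‖ ^ 2))) := by
        gcongr
        refine hvol.trans ((pow_le_pow_left₀ zero_le hsob' 2).trans ?_)
        rw [mul_pow]
        gcongr
    _ = ENNReal.ofReal ((S * M) ^ 2) * ∫⁻ x in A, ENNReal.ofReal (‖fderiv ℝ f x‖ ^ 2) := by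
        have hS : 0 ≤ S := NNReal.coe_nonneg _
        rw [← ENNReal.ofReal_pow hS, ← mul_assoc, ← mul_assoc,
          ← ENNReal.ofReal_mul (by positivity), ← ENNReal.ofReal_mul (by positivity)]
        congr 2
        field_simp
    _ ≤ _ := by
        gcongr
        linarith

/-! ### The Hardy-type inequality -/

/-- A Hardy-type inequality: a potential in weak `L³` is bounded from `H¹` to `L²`. -/
theorem exists_lintegral_weak_mul_sq_le :
    ∃ C : ℝ, 0 < C ∧ ∀ (w : R3 → ℝ), AEMeasurable w volume → (∀ x, 0 ≤ w x) →
      ∀ K : ℝ, 0 < K → (∀ s, 0 < s → volume {x | s ≤ w x} ≤ ENNReal.ofReal ((K / s) ^ 3)) →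
      ∀ f : 𝓢(R3, Spinor), ∫⁻ x, ENNReal.ofReal ((w x * ‖f x‖) ^ 2) ≤
        ENNReal.ofReal (C * K ^ 2) * ∫⁻ x, ENNReal.ofReal (‖fderiv ℝ f x‖ ^ 2) := by
  obtain ⟨C, hC0, hC⟩ := exists_levelSet_sobolev
  -- `144 = 16 · 9`: the `16` comes from `‖f‖ < 4 · 2^k` on a dyadic layer, the `9` from
  -- `setLIntegral_sq_le_of_measure_le`.
  refine ⟨144 * C, by positivity, fun w hw hw₀ K hK hwK f ↦ ?_⟩
  let E : ℤ → Set R3 := fun k ↦ {x | 2 * 2 ^ k ≤ ‖f x‖}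
  let A : ℤ → Set R3 := fun k ↦ {x | (2 : ℝ) ^ k < ‖f x‖ ∧ ‖f x‖ ≤ 2 * 2 ^ k}
  have hfm : Measurable fun x ↦ ‖f x‖ := f.continuous.norm.measurable
  have hEm : ∀ k, MeasurableSet (E k) := fun k ↦ measurableSet_le measurable_const hfm
  have hAm : ∀ k, MeasurableSet (A k) := fun k ↦
    (measurableSet_lt measurable_const hfm).inter (measurableSet_le hfm measurable_const)
  have hEfin : ∀ k, volume (E k) ≠ ∞ := by
    intro k
    obtain ⟨L, hL, hL'⟩ := exists_isCompact_le_norm f (s := 2 * 2 ^ k) (by positivity)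
    exact ((measure_mono hL').trans_lt hL.measure_lt_top).ne
  have hAd : Pairwise (Function.onFun Disjoint A) := by
    intro j k hjk
    refine Set.disjoint_left.2 fun x hx hx' ↦ hjk ?_
    have hlt : ∀ m n : ℤ, x ∈ A m → x ∈ A n → m < n + 1 := by
      intro m n hm hn
      rw [← zpow_lt_zpow_iff_right₀ (one_lt_two (α := ℝ)), zpow_add_one₀ two_ne_zero, mul_comm]
      exact hm.1.trans_le hn.2
    have h₁ := hlt j k hx hx'
    have h₂ := hlt k j hx' hx
    omega
  have hpt : ∀ x, ENNReal.ofReal ((w x * ‖f x‖) ^ 2) ≤ ∑' k : ℤ, (E k).indicator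
      (fun x ↦ ENNReal.ofReal (16 * (2 ^ k) ^ 2) * ENNReal.ofReal (w x ^ 2)) x := by
    intro x
    rcases (norm_nonneg (f x)).eq_or_lt with h0 | h0
    · simp [← h0]
    · obtain ⟨k, hk₁, hk₂⟩ := exists_mem_Ico_zpow (half_pos h0) one_lt_two
      rw [zpow_add_one₀ two_ne_zero] at hk₂
      refine le_trans ?_ (ENNReal.le_tsum k)
      rw [Set.indicator_of_mem (show x ∈ E k from (by linarith : 2 * 2 ^ k ≤ ‖f x‖)),
        ← ENNReal.ofReal_mul (by positivity)]
      apply ENNReal.ofReal_le_ofReal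
      calc (w x * ‖f x‖) ^ 2 ≤ (w x * (4 * 2 ^ k)) ^ 2 := by
            have := hw₀ x
            gcongr
            linarith
        _ = _ := by ring
  calc ∫⁻ x, ENNReal.ofReal ((w x * ‖f x‖) ^ 2)
      ≤ ∫⁻ x, ∑' k : ℤ, (E k).indicator
        (fun x ↦ ENNReal.ofReal (16 * (2 ^ k) ^ 2) * ENNReal.ofReal (w x ^ 2)) x :=
        lintegral_mono hpt
    _ = ∑' k : ℤ, ENNReal.ofReal (16 * (2 ^ k) ^ 2) * ∫⁻ x in E k, ENNReal.ofReal (w x ^ 2) := by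
        rw [lintegral_tsum fun k ↦ AEMeasurable.indicator
          ((hw.pow_const 2).ennreal_ofReal.const_mul _) (hEm k)]
        refine tsum_congr fun k ↦ ?_
        rw [lintegral_indicator (hEm k), lintegral_const_mul' _ _ ENNReal.ofReal_ne_top]
    -- The weak `L³` bound on `E k` produces `|E k|^(1/3)`, which the level-set Sobolev inequality
    -- at height `2^k` trades for the gradient on the shell `A k`.
    _ ≤ ∑' k : ℤ, ENNReal.ofReal (144 * C * K ^ 2) *
        ∫⁻ x in A k, ENNReal.ofReal (‖fderiv ℝ f x‖ ^ 2) := by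
        refine ENNReal.tsum_le_tsum fun k ↦ ?_
        have h₁ := setLIntegral_sq_le_of_measure_le hw hw₀ hK hwK (hEfin k)
        have h₂ := hC f (2 ^ k) (by positivity)
        calc _ ≤ ENNReal.ofReal (16 * (2 ^ k) ^ 2) *
              (ENNReal.ofReal (9 * K ^ 2) * volume (E k) ^ (1 / 3 : ℝ)) := by gcongr
          _ = ENNReal.ofReal (144 * K ^ 2) *
              (ENNReal.ofReal ((2 ^ k) ^ 2) * volume (E k) ^ (1 / 3 : ℝ)) := by
              rw [← mul_assoc, ← mul_assoc, ← ENNReal.ofReal_mul (by positivity),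
                ← ENNReal.ofReal_mul (by positivity)]
              congr 2
              ring
          _ ≤ ENNReal.ofReal (144 * K ^ 2) * (ENNReal.ofReal C *
              ∫⁻ x in A k, ENNReal.ofReal (‖fderiv ℝ f x‖ ^ 2)) := by gcongr
          _ = _ := by
              rw [← mul_assoc, ← ENNReal.ofReal_mul (by positivity)]
              congr 2
              ring
    _ = ENNReal.ofReal (144 * C * K ^ 2) *
        ∫⁻ x in ⋃ k, A k, ENNReal.ofReal (‖fderiv ℝ f x‖ ^ 2) := by
        rw [ENNReal.tsum_mul_left, lintegral_iUnion hAm hAd]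
    _ ≤ _ := by
        exact mul_le_mul_right (setLIntegral_le_lintegral _ _) _

theorem norm_fderiv_le_sum_lineDeriv (f : 𝓢(R3, Spinor)) (x : R3) :
    ‖fderiv ℝ f x‖ ≤ ∑ k : Fin 3, ‖(∂_{EuclideanSpace.single k (1 : ℝ)} f) x‖ := by
  refine ContinuousLinearMap.opNorm_le_bound _ (by positivity) fun v ↦ ?_
  have hv : v = ∑ k : Fin 3, v k • EuclideanSpace.single k (1 : ℝ) := by
    have := (EuclideanSpace.basisFun (Fin 3) ℝ).sum_repr v
    simpa using this.symm
  conv_lhs => rw [hv]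
  rw [map_sum, Finset.sum_mul]
  refine (norm_sum_le _ _).trans (Finset.sum_le_sum fun k _ ↦ ?_)
  rw [map_smul, norm_smul, SchwartzMap.lineDerivOp_apply_eq_fderiv, mul_comm]
  gcongr
  exact PiLp.norm_apply_le v k

theorem eLpNorm_fderiv_le (f : 𝓢(R3, Spinor)) :
    eLpNorm (fderiv ℝ f) 2 volume ≤ ∑ k, ‖partialDeriv k (schwartzH1 f)‖ₑ := by
  let g : Fin 3 → 𝓢(R3, Spinor) := fun k ↦ ∂_{EuclideanSpace.single k (1 : ℝ)} f
  have h : ∀ k, ‖partialDeriv k (schwartzH1 f)‖ₑ = eLpNorm (fun x ↦ ‖g k x‖) 2 volume := by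
    intro k
    rw [partialDeriv, weakDeriv_schwartzH1, Lp.enorm_def, eLpNorm_norm]
    exact eLpNorm_congr_ae (SchwartzMap.coeFn_toLp _ _ _)
  simp_rw [h]
  refine le_trans ?_ (eLpNorm_sum_le (fun k _ ↦
    (g k).continuous.norm.aestronglyMeasurable) (by norm_num))
  refine eLpNorm_mono_real fun x ↦ ?_
  rw [Finset.sum_apply]
  exact norm_fderiv_le_sum_lineDeriv f x

/-- A Hardy-type inequality: multiplication by a potential in `L^{3,∞}` is bounded from `H¹` to
`L²`. -/
theorem exists_eLpNorm_mul_le :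
    ∃ C : ℝ, 0 < C ∧ ∀ (V : R3 → Matrix (Fin 4) (Fin 4) ℂ),
      (∀ i j, AEMeasurable (fun x ↦ V x i j) volume) → ∀ c : ℝ, 0 < c →
      weakLorentzNorm 3 V ≤ ENNReal.ofReal c → ∀ ψ : sobolevH1,
      eLpNorm (fun x ↦ matrixOp (V x) ((ψ : L2) x)) 2 volume ≤
        ENNReal.ofReal (C * c) * ∑ k, ‖partialDeriv k ψ‖ₑ := by
  obtain ⟨C, hC0, hC⟩ := exists_lintegral_weak_mul_sq_le
  -- The distribution function of `|V|` is controlled with `K = 2c`, and `C (2c)² = (2 √C c)²`.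
  refine ⟨2 * √C, by positivity, fun V hV c hc hVc ψ ↦ ?_⟩
  have hw := aestronglyMeasurable_matrixOp hV
  have hS : ∀ f : 𝓢(R3, Spinor), eLpNorm (fun x ↦ matrixOp (V x) (f x)) 2 volume ≤
      ENNReal.ofReal (2 * √C * c) * ∑ k, ‖partialDeriv k (schwartzH1 f)‖ₑ := by
    intro f
    refine le_trans ?_ (mul_le_mul_right (eLpNorm_fderiv_le f) _)
    rw [← ENNReal.pow_le_pow_left_iff two_ne_zero, mul_pow, eLpNorm_two_sq, eLpNorm_two_sq,
      ← ENNReal.ofReal_pow (by positivity)]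
    have h := hC (fun x ↦ ‖matrixOp (V x)‖) hw.norm.aemeasurable (fun _ ↦ norm_nonneg _) (2 * c)
      (by positivity) (fun s hs ↦ measure_le_of_weakLorentzNorm_le hc hVc hs) f
    rw [show C * (2 * c) ^ 2 = (2 * √C * c) ^ 2 by
      rw [mul_pow, mul_pow, mul_pow, Real.sq_sqrt hC0.le]; ring] at h
    refine le_trans (lintegral_mono fun x ↦ ENNReal.ofReal_le_ofReal ?_) h
    gcongr
    exact ContinuousLinearMap.le_opNorm _ _
  -- Multiplication by `V` need not be continuous on `L²`, so the limit is taken almost everywhere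
  -- along a subsequence, and Fatou's lemma passes the bound to `ψ`.
  obtain ⟨f, hf, hf'⟩ := exists_seq_schwartz_tendsto ψ
  obtain ⟨n, hn, hae⟩ := (tendstoInMeasure_of_tendsto_Lp hf).exists_seq_tendsto_ae
  have hlim : Filter.Tendsto (fun j ↦ ENNReal.ofReal (2 * √C * c) *
      ∑ k, ‖partialDeriv k (schwartzH1 (f (n j)))‖ₑ) Filter.atTop
      (nhds (ENNReal.ofReal (2 * √C * c) * ∑ k, ‖partialDeriv k ψ‖ₑ)) := by
    refine ENNReal.Tendsto.const_mul (tendsto_finsetSum _ fun k _ ↦ ?_)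
      (Or.inr ENNReal.ofReal_ne_top)
    exact ((hf' _).comp hn.tendsto_atTop).enorm
  rw [← hlim.liminf_eq]
  have hcoe : ∀ᵐ x, ∀ j, (schwartzH1 (f (n j)) : L2) x = f (n j) x :=
    ae_all_iff.2 fun j ↦ SchwartzMap.coeFn_toLp _ _ _
  refine (Lp.eLpNorm_lim_le_liminf_eLpNorm (f := fun j x ↦ matrixOp (V x) (f (n j) x))
    (fun j ↦ aestronglyMeasurable_matrixOp_apply hV (f (n j)).continuous.aestronglyMeasurable) _
    ?_).trans (Filter.liminf_le_liminf (Filter.Eventually.of_forall fun j ↦ hS _))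
  filter_upwards [hae, hcoe] with x hx hx'
  simp only [hx'] at hx
  exact ((matrixOp (V x)).continuous.tendsto _).comp hx

/-! ### Self-adjointness of the perturbed operator -/

theorem mulOp_apply (V : R3 → Matrix (Fin 4) (Fin 4) ℂ) (ψ : mulDomain V) :
    mulOp V ψ = (memLp_mul ψ).toLp (fun x ↦ matrixOp (V x) ((ψ : L2) x)) :=
  rfl

theorem inner_mulOp {V : R3 → Matrix (Fin 4) (Fin 4) ℂ} (hV : ∀ᵐ x, (V x).IsHermitian)
    (φ ψ : mulDomain V) : inner ℂ (mulOp V φ) (ψ : L2) = inner ℂ (φ : L2) (mulOp V ψ) := by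
  rw [mulOp_apply, mulOp_apply]
  refine integral_congr_ae ?_
  filter_upwards [(memLp_mul φ).coeFn_toLp, (memLp_mul ψ).coeFn_toLp, hV] with x h₁ h₂ h₃
  rw [h₁, h₂, inner_matrixOp h₃]

theorem dense_sobolevH1 : Dense (sobolevH1 : Set L2) := by
  have h : DenseRange (SchwartzMap.toLpCLM ℂ Spinor 2 (volume : Measure R3)) :=
    SchwartzMap.denseRange_toLpCLM (by simp)
  refine Dense.mono ?_ h
  rintro _ ⟨f, rfl⟩
  exact toLp_mem_sobolevH1 f

theorem isSelfAdjoint_perturbedDirac {V : R3 → Matrix (Fin 4) (Fin 4) ℂ}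
    (hV : ∀ᵐ x, (V x).IsHermitian) (hle : sobolevH1 ≤ mulDomain V)
    {q : ℝ} (hq₀ : 0 ≤ q) (hq : q < 1)
    (hb : ∀ ψ : sobolevH1, ‖mulOp V ⟨ψ, hle ψ.2⟩‖ ≤ q * ‖freeDirac ψ‖) :
    IsSelfAdjoint (perturbedDirac V) := by
  have hdom : (perturbedDirac V).domain = freeDirac.domain := inf_eq_left.2 hle
  refine LinearPMap.isSelfAdjoint_of_relativelyBounded (A := freeDirac) (B := mulOp V) hdom
    inf_le_right (fun x _ _ ↦ LinearPMap.add_apply _ _ x) dense_sobolevH1 inner_freeDirac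
    (inner_mulOp hV) hq₀ hq (fun x _ ↦ hb x) (r := 2 * Real.pi) (by positivity) ?_ ?_
  · refine fun z ↦ exists_freeDirac_add_smul_eq ?_ z
    rw [mul_pow, Complex.I_sq]
    push_cast
    ring
  · intro z
    obtain ⟨x, hx⟩ := exists_freeDirac_add_smul_eq (c := -((2 * Real.pi : ℝ) * Complex.I)) (by
      rw [neg_sq, mul_pow, Complex.I_sq]
      push_cast
      ring) z
    exact ⟨x, by rw [← hx, neg_smul, sub_eq_add_neg]⟩

end DiracLorentz

end

theorem proposition2p2 :
    ∃ C₀ : ℝ, 0 < C₀ ∧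
      ∀ V : DiracLorentz.R3 → Matrix (Fin 4) (Fin 4) ℂ,
        (∀ i j, AEMeasurable (fun x ↦ V x i j) volume) →
        (∀ᵐ x, (V x).IsHermitian) →
        DiracLorentz.weakLorentzNorm 3 V ≤ ENNReal.ofReal C₀ →
        (DiracLorentz.perturbedDirac V).domain = DiracLorentz.sobolevH1 ∧
          IsSelfAdjoint (DiracLorentz.perturbedDirac V) := by
  obtain ⟨C, hC0, hC⟩ := DiracLorentz.exists_eLpNorm_mul_le
  -- Each of the three `‖∂ₖψ‖` is at most `‖𝒟ψ‖`, so the relative bound is `3 · C · C₀`, which this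
  -- choice makes `1/2`.
  refine ⟨1 / (6 * C), by positivity, fun V hV hVh hVn ↦ ?_⟩
  have hb := hC V hV _ (by positivity) hVn
  have hle : DiracLorentz.sobolevH1 ≤ DiracLorentz.mulDomain V := fun ψ hψ ↦
    ⟨DiracLorentz.aestronglyMeasurable_matrixOp_apply hV (Lp.aestronglyMeasurable ψ),
      (hb ⟨ψ, hψ⟩).trans_lt (ENNReal.mul_lt_top ENNReal.ofReal_lt_top
        (ENNReal.sum_lt_top.2 fun k _ ↦ enorm_lt_top))⟩
  refine ⟨inf_eq_left.2 hle, DiracLorentz.isSelfAdjoint_perturbedDirac hVh hle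
    (q := 1 / 2) (by norm_num) (by norm_num) fun ψ ↦ ?_⟩
  have h := hb ψ
  refine (Lp.norm_toLp _ (DiracLorentz.memLp_mul ⟨ψ, hle ψ.2⟩)).trans_le ?_
  refine ENNReal.toReal_le_of_le_ofReal (by positivity) (h.trans ?_)
  have hs : ∑ k, ‖DiracLorentz.partialDeriv k ψ‖ₑ ≤
      ENNReal.ofReal (3 * ‖DiracLorentz.freeDirac ψ‖) := by
    simp_rw [← ofReal_norm]
    rw [← ENNReal.ofReal_sum_of_nonneg fun _ _ ↦ norm_nonneg _]
    apply ENNReal.ofReal_le_ofReal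
    refine (Finset.sum_le_card_nsmul _ _ _ fun k _ ↦
      DiracLorentz.norm_partialDeriv_le k ψ).trans_eq ?_
    simp
  refine (mul_le_mul_right hs _).trans_eq ?_
  rw [← ENNReal.ofReal_mul (by positivity)]
  congr 1
  field_simp
  ring
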